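/- Let $d\ge 1$ and let $X_0,X_1,\dots,X_d$ be independent standard Gaussian random vectors in $\mathbb{R}^d$. Let $\sigma_0,\dots,\sigma_d>0$, let $l\in\{1,\dots,d\}$, and let $0=i_0<i_1<\dots<i_l\le d$ be integers. Define random vectors $Y_0,\dots,Y_d$ (the points of $l+1$ weighted Gaussian random walks, restarted at the indices $i_0,\dots,i_l$) by $$ Y_k=\begin{cases}\sigma_k X_k, & k\in\{i_0,i_1,\dots,i_l\},\\ Y_{k-1}+\sigma_k X_k, & k\in\{0,\dots,d\}\setminus\{i_0,i_1,\dots,i_l\}.\end{cases} $$ Let $|\mathrm{conv}(Y_0,\dots,Y_d)|$ denote the $d$-dimensional volume of the simplex with vertices $Y_0,\dots,Y_d$. Then for every real $p>0$ its $p$-th moment is finite and $$ \mathbb{E}\,|\mathrm{conv}(Y_0,\dots,Y_d)|^p=\left[\frac{2^{d/2}\,\sigma_0\cdots\sigma_d}{d!}\sqrt{\frac{1}{\sigma_{i_0}^2}+\dots+\frac{1}{\sigma_{i_l}^2}}\,\right]^p\prod_{i=1}^{d}\frac{\Gamma\big(\frac{i+p}{2}\big)}{\Gamma\big(\frac{i}{2}\big)}.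 $$ -/

import Mathlib

open MeasureTheory ProbabilityTheory

open Classical in
/-- The positions of the walks with steps `v 0, …, v d`, where a new walk starts at every index in
`R` (and at `0`): the position at a starting index is the step itself, and at any other index it is
the previous position plus the step. -/
noncomputable def restartedWalk {d : ℕ} {E : Type*} [AddCommGroup E] (R : Set (Fin (d + 1)))
    (v : Fin (d + 1) → E) : Fin (d + 1) → E :=
  Fin.induction (motive := fun _ => E) (v 0)
    (fun k y => if k.succ ∈ R then v k.succ else y + v k.succ)

/-! The volume is `|det M| / d!`, where row `k` of `M` is `(1, Y k)`. Subtracting from each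
non-restart row its predecessor leaves the step `σ k • X k`, preceded by 1 at restarts and 0
elsewhere. Taking `σ k` out of row `k` leaves `∏ σ` times a determinant with one deterministic
column `u`, whose entries are `1 / σ k` at restarts and 0 elsewhere. The other `d` columns are
independent standard Gaussian vectors in dimension `d + 1`, so rotating `u` onto the first axis
gives, in law, `‖u‖` times the absolute determinant of a `d × d` Gaussian matrix
(`lintegral_det_rowMatrix_cons`). The same identity with a random first row lowers the size of a
Gaussian matrix by one at the cost of a moment of a Gaussian norm, which produces the Gamma
quotients (`gaussianDetMoment_eq`). -/

/-! ### Density and norm moments of the standard Gaussian -/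

theorem stdGaussian_eq_withDensity (ι : Type*) [Fintype ι] :
    stdGaussian (EuclideanSpace ℝ ι) = (volume : Measure (EuclideanSpace ℝ ι)).withDensity
      (fun x => ENNReal.ofReal
        ((2 * Real.pi) ^ (-((Fintype.card ι : ℝ) / 2)) * Real.exp (-(1 / 2) * ‖x‖ ^ 2))) := by
  have hpi := Real.pi_pos
  set c : ℝ := (2 * Real.pi) ^ (-((Fintype.card ι : ℝ) / 2)) with hc
  have hc0 : 0 < c := by positivity
  have hI : Integrable (fun x : EuclideanSpace ℝ ι => Real.exp (-(1 / 2) * ‖x‖ ^ 2)) := by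
    -- A non-integrable function has Bochner integral 0, so a nonzero value proves integrability.
    refine .of_integral_ne_zero ?_
    rw [GaussianFourier.integral_rexp_neg_mul_sq_norm (by norm_num)]
    positivity
  have hfin : IsFiniteMeasure ((volume : Measure (EuclideanSpace ℝ ι)).withDensity
      (fun x => ENNReal.ofReal (c * Real.exp (-(1 / 2) * ‖x‖ ^ 2)))) :=
    isFiniteMeasure_withDensity_ofReal (hI.const_mul c).2
  refine Measure.ext_of_charFun (funext fun t => ?_)
  rw [charFun_stdGaussian, charFun_apply,
    integral_withDensity_eq_integral_toReal_smul (by fun_prop) (by simp)]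
  have hrw : ∀ x : EuclideanSpace ℝ ι,
      (ENNReal.ofReal (c * Real.exp (-(1 / 2) * ‖x‖ ^ 2))).toReal •
        Complex.exp (↑(inner ℝ x t) * Complex.I) =
      (c : ℂ) * Complex.exp (-(1 / 2 : ℂ) * ‖x‖ ^ 2 + Complex.I * inner ℝ t x) := by
    intro x
    rw [ENNReal.toReal_ofReal (by positivity), Complex.real_smul, Complex.exp_add,
      real_inner_comm]
    push_cast
    ring_nf
  simp_rw [hrw]
  rw [integral_const_mul, GaussianFourier.integral_cexp_neg_mul_sq_norm_add (by norm_num),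
    finrank_euclideanSpace, ← mul_assoc]
  have h1 : (c : ℂ) * ((Real.pi : ℂ) / (1 / 2)) ^ ((Fintype.card ι : ℂ) / 2) = 1 := by
    have : ((Real.pi : ℂ) / (1 / 2)) ^ ((Fintype.card ι : ℂ) / 2) =
        (((2 * Real.pi) ^ ((Fintype.card ι : ℝ) / 2) : ℝ) : ℂ) := by
      rw [Complex.ofReal_cpow (by positivity)]
      push_cast
      congr 1
      ring
    rw [this, ← Complex.ofReal_mul, hc, ← Real.rpow_add (by positivity)]
    simp
  rw [h1, one_mul, Complex.I_sq]
  congr 1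
  ring

/-- Polar coordinates reduce this to a one-dimensional Gamma integral. -/
theorem integral_norm_rpow_stdGaussian (ι : Type*) [Fintype ι] [Nonempty ι] {p : ℝ} (hp : 0 < p) :
    ∫ x, ‖x‖ ^ p ∂(stdGaussian (EuclideanSpace ℝ ι)) =
      2 ^ (p / 2) * (Real.Gamma (((Fintype.card ι : ℝ) + p) / 2) /
        Real.Gamma ((Fintype.card ι : ℝ) / 2)) := by
  have hpi := Real.pi_pos
  set m : ℕ := Fintype.card ι with hm
  have hm0 : 0 < m := Fintype.card_pos
  have hm0' : (0 : ℝ) < m := by exact_mod_cast hm0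
  rw [stdGaussian_eq_withDensity,
    integral_withDensity_eq_integral_toReal_smul (by fun_prop) (by simp)]
  set c : ℝ := (2 * Real.pi) ^ (-((m : ℝ) / 2)) with hc
  have h1 : ∀ x : EuclideanSpace ℝ ι,
      (ENNReal.ofReal (c * Real.exp (-(1 / 2) * ‖x‖ ^ 2))).toReal • ‖x‖ ^ p =
      (fun y : ℝ => c * Real.exp (-(1 / 2) * y ^ 2) * y ^ p) ‖x‖ := by
    intro x
    rw [ENNReal.toReal_ofReal (by positivity), smul_eq_mul]
  simp_rw [h1]
  rw [integral_fun_norm_addHaar volume (fun y : ℝ => c * Real.exp (-(1 / 2) * y ^ 2) * y ^ p),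
    finrank_euclideanSpace, ← hm]
  have h2 : ∫ y in Set.Ioi (0 : ℝ), y ^ (m - 1) • (c * Real.exp (-(1 / 2) * y ^ 2) * y ^ p) =
      c * ∫ y in Set.Ioi (0 : ℝ), y ^ ((m : ℝ) - 1 + p) * Real.exp (-(1 / 2) * y ^ (2 : ℝ)) := by
    rw [← integral_const_mul]
    refine setIntegral_congr_fun measurableSet_Ioi fun y (hy : 0 < y) => ?_
    simp only [smul_eq_mul]
    rw [Real.rpow_add hy, ← Real.rpow_natCast y (m - 1), Nat.cast_sub (by omega), Real.rpow_two]
    push_cast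
    ring
  rw [h2, integral_rpow_mul_exp_neg_mul_rpow (by norm_num) (by linarith) (by norm_num),
    Measure.real, EuclideanSpace.volume_ball, ENNReal.ofReal_one, one_pow, one_mul,
    ENNReal.toReal_ofReal (by positivity), Real.Gamma_add_one (by positivity), hm]
  simp only [smul_eq_mul, nsmul_eq_mul, ← hm]
  have h3 : ((m : ℝ) - 1 + p + 1) = m + p := by ring
  have h4 : (1 / 2 : ℝ) ^ (-((m : ℝ) + p) / 2) = 2 ^ ((m : ℝ) / 2) * 2 ^ (p / 2) := by
    rw [← Real.rpow_add (by norm_num), one_div, Real.inv_rpow (by norm_num),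
      ← Real.rpow_neg (by norm_num)]
    congr 1
    ring
  have h5 : c = ((2 : ℝ) ^ ((m : ℝ) / 2))⁻¹ * (√Real.pi ^ m)⁻¹ := by
    rw [hc, Real.rpow_neg (by positivity), Real.mul_rpow (by norm_num) hpi.le, mul_inv]
    congr 2
    rw [Real.sqrt_eq_rpow, ← Real.rpow_natCast, ← Real.rpow_mul hpi.le]
    congr 1
    ring
  have hG : 0 < Real.Gamma ((m : ℝ) / 2) := Real.Gamma_pos_of_pos (by positivity)
  rw [h3, h4, h5]
  field_simp

theorem lintegral_norm_rpow_stdGaussian (ι : Type*) [Fintype ι] [Nonempty ι] {p : ℝ}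
    (hp : 0 < p) :
    ∫⁻ x, ENNReal.ofReal (‖x‖ ^ p) ∂(stdGaussian (EuclideanSpace ℝ ι)) =
      ENNReal.ofReal (2 ^ (p / 2) * (Real.Gamma (((Fintype.card ι : ℝ) + p) / 2) /
        Real.Gamma ((Fintype.card ι : ℝ) / 2))) := by
  have hm0 : (0 : ℝ) < Fintype.card ι := by exact_mod_cast Fintype.card_pos
  have h := integral_norm_rpow_stdGaussian ι hp
  rw [← h, ofReal_integral_eq_lintegral_ofReal]
  · refine .of_integral_ne_zero ?_
    have h1 := Real.Gamma_pos_of_pos (s := ((Fintype.card ι : ℝ) + p) / 2) (by positivity)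
    have h2 := Real.Gamma_pos_of_pos (s := (Fintype.card ι : ℝ) / 2) (by positivity)
    rw [h]
    positivity
  · exact .of_forall fun x => by positivity

/-! ### Coordinates and transposes of Gaussian arrays -/

theorem measurePreserving_toLp_stdGaussian (ι : Type*) [Fintype ι] :
    MeasurePreserving (WithLp.toLp 2) (Measure.pi fun _ : ι => gaussianReal 0 1)
      (stdGaussian (EuclideanSpace ℝ ι)) :=
  ⟨by fun_prop, map_pi_eq_stdGaussian⟩

theorem measurePreserving_ofLp_stdGaussian (ι : Type*) [Fintype ι] :
    MeasurePreserving (WithLp.ofLp) (stdGaussian (EuclideanSpace ℝ ι))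
      (Measure.pi fun _ : ι => gaussianReal 0 1) :=
  (measurePreserving_toLp_stdGaussian ι).symm (MeasurableEquiv.toLp 2 (ι → ℝ))

theorem measurePreserving_tail_stdGaussian (n : ℕ) :
    MeasurePreserving (fun x : EuclideanSpace ℝ (Fin (n + 1)) =>
        WithLp.toLp 2 (fun j : Fin n => x j.succ))
      (stdGaussian (EuclideanSpace ℝ (Fin (n + 1)))) (stdGaussian (EuclideanSpace ℝ (Fin n))) :=
  (measurePreserving_toLp_stdGaussian (Fin n)).comp
    (measurePreserving_snd.comp
      ((measurePreserving_piFinSuccAbove (fun _ : Fin (n + 1) => gaussianReal 0 1) 0).comp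
        (measurePreserving_ofLp_stdGaussian (Fin (n + 1)))))

theorem measurePreserving_curry_pi {ι κ X : Type*} [Fintype ι] [Fintype κ] [MeasurableSpace X]
    (μ : Measure X) [IsProbabilityMeasure μ] :
    MeasurePreserving (MeasurableEquiv.curry ι κ X) (Measure.pi fun _ : ι × κ => μ)
      (Measure.pi fun _ : ι => Measure.pi fun _ : κ => μ) := by
  refine ⟨(MeasurableEquiv.curry ι κ X).measurable, ?_⟩
  simpa only [Measure.infinitePi_eq_pi] using
    Measure.infinitePi_map_curry (fun (_ : ι) (_ : κ) => μ)

theorem measurePreserving_swap_pi {ι κ X : Type*} [Fintype ι] [Fintype κ] [MeasurableSpace X]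
    (μ : Measure X) [IsProbabilityMeasure μ] :
    MeasurePreserving (fun (x : ι → κ → X) j i => x i j)
      (Measure.pi fun _ : ι => Measure.pi fun _ : κ => μ)
      (Measure.pi fun _ : κ => Measure.pi fun _ : ι => μ) := by
  convert! (measurePreserving_curry_pi (ι := κ) (κ := ι) μ).comp
    ((measurePreserving_piCongrLeft (fun _ : κ × ι => μ) (Equiv.prodComm ι κ)).comp
      ((measurePreserving_curry_pi (ι := ι) (κ := κ) μ).symm _)) using 1

/-- The entries are i.i.d. scalars, so rows and columns play the same role. This turns the points `X
k` into columns independent of each other. -/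
theorem measurePreserving_transpose_stdGaussian (ι κ : Type*) [Fintype ι] [Fintype κ] :
    MeasurePreserving (fun (x : ι → EuclideanSpace ℝ κ) (j : κ) =>
        (WithLp.toLp 2 fun i => x i j : EuclideanSpace ℝ ι))
      (Measure.pi fun _ => stdGaussian (EuclideanSpace ℝ κ))
      (Measure.pi fun _ => stdGaussian (EuclideanSpace ℝ ι)) :=
  (measurePreserving_pi _ _ fun _ => measurePreserving_toLp_stdGaussian ι).comp
    ((measurePreserving_swap_pi (gaussianReal 0 1)).comp
      (measurePreserving_pi _ _ fun _ => measurePreserving_ofLp_stdGaussian κ))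

/-! ### Moments of Gaussian determinants -/

/-- The matrix whose rows are the given vectors. -/
def rowMatrix {m n : ℕ} (c : Fin m → EuclideanSpace ℝ (Fin n)) : Matrix (Fin m) (Fin n) ℝ :=
  Matrix.of fun i j => c i j

theorem measurable_det_rowMatrix {n : ℕ} :
    Measurable fun c : Fin n → EuclideanSpace ℝ (Fin n) => (rowMatrix c).det := by
  refine Continuous.measurable (Continuous.matrix_det ?_)
  unfold rowMatrix
  fun_prop

theorem abs_det_rowMatrix_repr {n : ℕ} (b : OrthonormalBasis (Fin n) ℝ (EuclideanSpace ℝ (Fin n)))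
    (c : Fin n → EuclideanSpace ℝ (Fin n)) :
    |(rowMatrix fun i => b.repr (c i)).det| = |(rowMatrix c).det| := by
  set e := EuclideanSpace.basisFun (Fin n) ℝ
  have h1 : (rowMatrix fun i => b.repr (c i)).det = b.toBasis.det c := by
    rw [Module.Basis.det_apply, ← Matrix.det_transpose]
    congr 1
  have h2 : (rowMatrix c).det = e.toBasis.det c := by
    rw [Module.Basis.det_apply, ← Matrix.det_transpose]
    congr 1
  have h3 : b.toBasis.det c = b.toBasis.det e * e.toBasis.det c := by
    have h := congrArg (fun f => f c) (b.toBasis.det.eq_smul_basis_det e.toBasis)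
    simpa using h
  rw [h1, h2, h3, abs_mul]
  rcases b.det_to_matrix_orthonormalBasis_real e with h | h <;> simp [h]

theorem exists_orthonormalBasis_repr_eq {n : ℕ} (u : EuclideanSpace ℝ (Fin (n + 1))) :
    ∃ b : OrthonormalBasis (Fin (n + 1)) ℝ (EuclideanSpace ℝ (Fin (n + 1))),
      b.repr u = EuclideanSpace.single 0 ‖u‖ := by
  rcases eq_or_ne u 0 with rfl | hu
  · exact ⟨EuclideanSpace.basisFun _ ℝ, by ext i; simp⟩
  have hu' : ‖u‖ ≠ 0 := norm_ne_zero_iff.mpr hu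
  -- Only the value at index 0 is prescribed, so a constant family suffices.
  obtain ⟨b, hb⟩ := Orthonormal.exists_orthonormalBasis_extension_of_card_eq (𝕜 := ℝ)
    (E := EuclideanSpace ℝ (Fin (n + 1))) (ι := Fin (n + 1)) (by simp)
    (v := fun _ => ‖u‖⁻¹ • u) (s := {0}) ⟨fun i => by simp [norm_smul, hu'],
      fun i j hij => (hij (Subsingleton.elim _ _)).elim⟩
  refine ⟨b, ?_⟩
  have h : u = ‖u‖ • b 0 := by rw [hb 0 rfl, smul_smul, mul_inv_cancel₀ hu', one_smul]
  conv_lhs => rw [h]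
  rw [map_smul, OrthonormalBasis.repr_self]
  ext i
  simp

theorem det_rowMatrix_cons_single {n : ℕ} (r : ℝ) (c : Fin n → EuclideanSpace ℝ (Fin (n + 1))) :
    (rowMatrix (Fin.cons (EuclideanSpace.single 0 r) c : Fin (n + 1) → _)).det =
      r * (rowMatrix fun i => WithLp.toLp 2 fun j : Fin n => c i j.succ).det := by
  rw [Matrix.det_succ_row_zero, Finset.sum_eq_single 0]
  · simp only [rowMatrix, Matrix.of_apply, Fin.cons_zero, Fin.val_zero, pow_zero, one_mul,
      PiLp.single_apply, if_true]
    congr 2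
  · intro j _ hj
    simp [rowMatrix, hj]
  · simp

/-- The absolute moment of order `p` of the determinant of a standard Gaussian square matrix. -/
noncomputable def gaussianDetMoment (p : ℝ) (n : ℕ) : ENNReal :=
  ∫⁻ c : Fin n → EuclideanSpace ℝ (Fin n), ENNReal.ofReal (|(rowMatrix c).det| ^ p)
    ∂Measure.pi fun _ => stdGaussian (EuclideanSpace ℝ (Fin n))

/-- An orthonormal basis whose first vector points along `u` changes neither `|det|` nor the law of
the other rows. Expanding along the first row then deletes the first coordinate of each. -/
theorem lintegral_det_rowMatrix_cons {n : ℕ} (p : ℝ) (u : EuclideanSpace ℝ (Fin (n + 1))) :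
    ∫⁻ c : Fin n → EuclideanSpace ℝ (Fin (n + 1)),
      ENNReal.ofReal (|(rowMatrix (Fin.cons u c : Fin (n + 1) → _)).det| ^ p)
      ∂(Measure.pi fun _ => stdGaussian (EuclideanSpace ℝ (Fin (n + 1)))) =
    ENNReal.ofReal (‖u‖ ^ p) * gaussianDetMoment p n := by
  obtain ⟨b, hb⟩ := exists_orthonormalBasis_repr_eq u
  have hT : MeasurePreserving (fun (c : Fin n → EuclideanSpace ℝ (Fin (n + 1))) i =>
      (WithLp.toLp 2 fun j : Fin n => b.repr (c i) j.succ : EuclideanSpace ℝ (Fin n)))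
      (Measure.pi fun _ => stdGaussian (EuclideanSpace ℝ (Fin (n + 1))))
      (Measure.pi fun _ => stdGaussian (EuclideanSpace ℝ (Fin n))) :=
    measurePreserving_pi _ _ fun _ => (measurePreserving_tail_stdGaussian n).comp
      ⟨by fun_prop, stdGaussian_map b.repr⟩
  have hdet : ∀ c : Fin n → EuclideanSpace ℝ (Fin (n + 1)),
      |(rowMatrix (Fin.cons u c : Fin (n + 1) → _)).det| = ‖u‖ *
        |(rowMatrix fun i => WithLp.toLp 2 fun j : Fin n => b.repr (c i) j.succ).det| := by
    intro c
    rw [← abs_det_rowMatrix_repr b]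
    have : (fun i => b.repr ((Fin.cons u c : Fin (n + 1) → EuclideanSpace ℝ (Fin (n + 1))) i)) =
        Fin.cons (EuclideanSpace.single 0 ‖u‖) (fun i => b.repr (c i)) := by
      funext i
      refine Fin.cases ?_ (fun i => ?_) i <;> simp [hb]
    rw [this, det_rowMatrix_cons_single, abs_mul, abs_norm]
  have hm : Measurable fun c : Fin n → EuclideanSpace ℝ (Fin n) =>
      ENNReal.ofReal (|(rowMatrix c).det| ^ p) :=
    ((measurable_det_rowMatrix.abs).pow_const p).ennreal_ofReal
  simp_rw [hdet, Real.mul_rpow (norm_nonneg _) (abs_nonneg _),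
    ENNReal.ofReal_mul (Real.rpow_nonneg (norm_nonneg u) p)]
  have hm' := hm.comp hT.measurable
  simp only [Function.comp_def] at hm'
  rw [lintegral_const_mul _ hm', gaussianDetMoment, ← hT.lintegral_comp hm]

/-- Fubini: integrate over the other rows with the first one fixed. -/
theorem gaussianDetMoment_succ {p : ℝ} (hp : 0 < p) (n : ℕ) :
    gaussianDetMoment p (n + 1) = ENNReal.ofReal (2 ^ (p / 2) *
      (Real.Gamma ((((n + 1 : ℕ) : ℝ) + p) / 2) / Real.Gamma (((n + 1 : ℕ) : ℝ) / 2))) *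
        gaussianDetMoment p n := by
  have hm : Measurable fun c : Fin (n + 1) → EuclideanSpace ℝ (Fin (n + 1)) =>
      ENNReal.ofReal (|(rowMatrix c).det| ^ p) :=
    ((measurable_det_rowMatrix.abs).pow_const p).ennreal_ofReal
  set γ := stdGaussian (EuclideanSpace ℝ (Fin (n + 1)))
  have hS := (measurePreserving_piFinSuccAbove (fun _ : Fin (n + 1) => γ) 0).symm
  have hnorm := lintegral_norm_rpow_stdGaussian (Fin (n + 1)) hp
  rw [Fintype.card_fin] at hnorm
  have hm' := hm.comp hS.measurable
  simp only [Function.comp_def] at hm'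
  rw [gaussianDetMoment, ← hS.lintegral_comp hm, lintegral_prod _ hm'.aemeasurable, ← hnorm,
    ← lintegral_mul_const _ (by fun_prop)]
  refine lintegral_congr fun u => ?_
  rw [← lintegral_det_rowMatrix_cons]
  refine lintegral_congr fun c => ?_
  simp [MeasurableEquiv.piFinSuccAbove, Fin.insertNthEquiv]

theorem gaussianDetMoment_eq {p : ℝ} (hp : 0 < p) (n : ℕ) :
    gaussianDetMoment p n = ENNReal.ofReal (∏ k ∈ Finset.Icc 1 n, 2 ^ (p / 2) *
      (Real.Gamma (((k : ℝ) + p) / 2) / Real.Gamma ((k : ℝ) / 2))) := by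
  induction n with
  | zero => simp [gaussianDetMoment]
  | succ n ih =>
    have h1 := Real.Gamma_pos_of_pos (s := (((n + 1 : ℕ) : ℝ) + p) / 2) (by positivity)
    have h2 := Real.Gamma_pos_of_pos (s := ((n + 1 : ℕ) : ℝ) / 2) (by positivity)
    rw [gaussianDetMoment_succ hp, ih, ← ENNReal.ofReal_mul (by positivity),
      ← Finset.insert_Icc_right_eq_Icc_add_one (by omega), Finset.prod_insert (by simp)]

/-! ### Volume of a simplex as a determinant -/

/-- Slicing at first coordinate `s` gives the simplex of size `t - s`, so the induction needs
arbitrary `t`. -/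
theorem volume_solidSimplex (n : ℕ) {t : ℝ} (ht : 0 ≤ t) :
    volume {x : Fin n → ℝ | (∀ i, 0 ≤ x i) ∧ ∑ i, x i ≤ t} =
      ENNReal.ofReal (t ^ n / n.factorial) := by
  induction n generalizing t with
  | zero => simp [ht, volume_pi]
  | succ n ih =>
    have hmeas : MeasurableSet {x : Fin (n + 1) → ℝ | (∀ i, 0 ≤ x i) ∧ ∑ i, x i ≤ t} := by
      measurability
    have hS := (volume_preserving_piFinSuccAbove (fun _ : Fin (n + 1) => ℝ) 0).symm
    rw [← hS.measure_preimage hmeas.nullMeasurableSet, Measure.volume_eq_prod,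
      Measure.prod_apply (hS.measurable hmeas)]
    have hslice : ∀ s : ℝ, volume (Prod.mk s ⁻¹'
        ((MeasurableEquiv.piFinSuccAbove (fun _ : Fin (n + 1) => ℝ) 0).symm ⁻¹'
          {x : Fin (n + 1) → ℝ | (∀ i, 0 ≤ x i) ∧ ∑ i, x i ≤ t})) =
        (Set.Icc 0 t).indicator (fun s => ENNReal.ofReal ((t - s) ^ n / n.factorial)) s := by
      intro s
      have hset : Prod.mk s ⁻¹'
          ((MeasurableEquiv.piFinSuccAbove (fun _ : Fin (n + 1) => ℝ) 0).symm ⁻¹'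
            {x : Fin (n + 1) → ℝ | (∀ i, 0 ≤ x i) ∧ ∑ i, x i ≤ t}) =
          {x : Fin n → ℝ | 0 ≤ s ∧ (∀ i, 0 ≤ x i) ∧ ∑ i, x i ≤ t - s} := by
        ext x
        simp [MeasurableEquiv.piFinSuccAbove, Fin.insertNthEquiv, Fin.forall_fin_succ,
          Fin.sum_univ_succ, le_sub_iff_add_le', and_assoc]
      rw [hset]
      by_cases hs : s ∈ Set.Icc 0 t
      · rw [Set.indicator_of_mem hs, ← ih (sub_nonneg.mpr hs.2)]
        simp [hs.1]
      · rw [Set.indicator_of_notMem hs]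
        convert measure_empty (μ := volume)
        refine Set.eq_empty_of_forall_notMem fun x ⟨h0, hx, hx'⟩ => hs ⟨h0, ?_⟩
        linarith [Finset.sum_nonneg fun i (_ : i ∈ Finset.univ) => hx i]
    simp_rw [hslice]
    rw [lintegral_indicator measurableSet_Icc, ← ofReal_integral_eq_lintegral_ofReal,
      integral_Icc_eq_integral_Ioc, ← intervalIntegral.integral_of_le ht,
      intervalIntegral.integral_div,
      intervalIntegral.integral_comp_sub_left (fun x : ℝ => x ^ n), integral_pow]
    · congr 1
      rw [Nat.factorial_succ]
      push_cast
      field_simp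
      simp
    · exact ContinuousOn.integrableOn_Icc (by fun_prop)
    · refine (ae_restrict_iff' measurableSet_Icc).mpr (.of_forall fun s hs => ?_)
      have := sub_nonneg.mpr hs.2
      positivity

/-- The barycentric weight of `y 0` is eliminated as one minus the others. -/
theorem convexHull_range_eq_image {d : ℕ} {E : Type*} [AddCommGroup E] [Module ℝ E]
    (y : Fin (d + 1) → E) :
    convexHull ℝ (Set.range y) = (fun z => y 0 + z) '' ((fun x : Fin d → ℝ =>
      ∑ k, x k • (y k.succ - y 0)) '' {x : Fin d → ℝ | (∀ i, 0 ≤ x i) ∧ ∑ i, x i ≤ 1}) := by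
  have hrange : Set.range y =
      Fintype.linearCombination ℝ y '' Set.range fun i => Pi.single i (1 : ℝ) := by
    rw [← Set.range_comp]
    congr 1
    funext i
    simp
  rw [hrange, ← LinearMap.image_convexHull, convexHull_rangle_single_eq_stdSimplex]
  have hsum : ∀ w : Fin (d + 1) → ℝ, ∑ i, w i = 1 →
      Fintype.linearCombination ℝ y w = y 0 + ∑ k : Fin d, w k.succ • (y k.succ - y 0) := by
    intro w hw
    rw [Fin.sum_univ_succ] at hw
    simp only [Fintype.linearCombination_apply, Fin.sum_univ_succ, smul_sub,
      Finset.sum_sub_distrib, ← Finset.sum_smul]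
    rw [eq_sub_of_add_eq hw, sub_smul, one_smul]
    abel
  ext z
  simp only [Set.mem_image, exists_exists_and_eq_and, Set.mem_ofPred_eq]
  constructor
  · rintro ⟨w, ⟨hw, hw1⟩, rfl⟩
    refine ⟨fun k => w k.succ, ⟨fun k => hw _, ?_⟩, (hsum w hw1).symm⟩
    rw [Fin.sum_univ_succ] at hw1
    linarith [hw 0]
  · rintro ⟨x, ⟨hx, hx1⟩, rfl⟩
    have h1 : ∑ i, (Fin.cons (1 - ∑ k, x k) x : Fin (d + 1) → ℝ) i = 1 := by
      simp [Fin.sum_univ_succ]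
    refine ⟨Fin.cons (1 - ∑ k, x k) x, ⟨fun k => ?_, h1⟩, ?_⟩
    · refine Fin.cases ?_ (fun k => ?_) k
      · simpa using hx1
      · simpa using hx k
    · rw [hsum _ h1]
      simp

theorem volume_convexHull_range {d : ℕ} (y : Fin (d + 1) → EuclideanSpace ℝ (Fin d)) :
    volume (convexHull ℝ (Set.range y)) =
      ENNReal.ofReal (|(rowMatrix fun k : Fin d => y k.succ - y 0).det| / d.factorial) := by
  set z := fun k : Fin d => y k.succ - y 0
  set e := EuclideanSpace.basisFun (Fin d) ℝ
  set S : Set (Fin d → ℝ) := {x | (∀ i, 0 ≤ x i) ∧ ∑ i, x i ≤ 1}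
  set f : EuclideanSpace ℝ (Fin d) →ₗ[ℝ] EuclideanSpace ℝ (Fin d) := e.toBasis.constr ℝ z
  have hf : (fun x : Fin d → ℝ => ∑ k, x k • z k) '' S =
      f '' ((WithLp.ofLp : EuclideanSpace ℝ (Fin d) → _) ⁻¹' S) := by
    have h : ∀ x : EuclideanSpace ℝ (Fin d), f x = ∑ k, x k • z k := fun x => by
      simp [f, e, Module.Basis.constr_apply_fintype]
    ext w
    constructor
    · rintro ⟨x, hx, rfl⟩
      exact ⟨WithLp.toLp 2 x, hx, h _⟩
    · rintro ⟨x, hx, rfl⟩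
      exact ⟨x.ofLp, hx, (h _).symm⟩
  have hdet : LinearMap.det f = (rowMatrix z).det := by
    rw [← LinearMap.det_toMatrix e.toBasis, ← Matrix.det_transpose]
    congr 1
    ext i j
    simp [LinearMap.toMatrix_apply, f, rowMatrix, e]
  have hS : MeasurableSet S := by
    measurability
  rw [convexHull_range_eq_image, Set.image_add_left, measure_preimage_add, hf,
    Measure.addHaar_image_linearMap, hdet,
    (PiLp.volume_preserving_ofLp (Fin d)).measure_preimage hS.nullMeasurableSet,
    volume_solidSimplex d zero_le_one, ← ENNReal.ofReal_mul (abs_nonneg _)]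
  congr 1
  ring

/-! ### Row operations on the walk matrix -/

theorem det_diff_rows {d : ℕ} (y : Fin (d + 1) → EuclideanSpace ℝ (Fin d)) :
    (rowMatrix fun k : Fin d => y k.succ - y 0).det =
      (Matrix.of fun k => (Fin.cons 1 (y k).ofLp : Fin (d + 1) → ℝ)).det := by
  rw [Matrix.det_eq_of_forall_row_eq_smul_add_const
    (A := Matrix.of fun k => (Fin.cons 1 (y k).ofLp : Fin (d + 1) → ℝ))
    (B := Matrix.of (Fin.cons (Fin.cons 1 (y 0).ofLp)
      fun k : Fin d => (Fin.cons 0 (y k.succ - y 0).ofLp : Fin (d + 1) → ℝ)))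
    -- Row 0 is kept and is subtracted once from every other row.
    (Fin.cons 0 fun _ => 1) 0 rfl]
  · rw [Matrix.det_succ_column_zero, Finset.sum_eq_single 0]
    · simp only [Matrix.of_apply, Fin.cons_zero, Fin.val_zero, pow_zero, one_mul]
      congr 1
    · intro k _ hk
      obtain ⟨k, rfl⟩ := Fin.exists_succ_eq.mpr hk
      simp
    · simp
  · intro k j
    refine Fin.cases ?_ (fun k => ?_) k <;> refine Fin.cases ?_ (fun j => ?_) j <;> simp

open Classical in
theorem det_restartedWalk {d : ℕ} {R : Set (Fin (d + 1))} (hR : 0 ∈ R)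
    (v : Fin (d + 1) → EuclideanSpace ℝ (Fin d)) :
    (Matrix.of fun k => (Fin.cons 1 (restartedWalk R v k).ofLp : Fin (d + 1) → ℝ)).det =
      (Matrix.of fun k => (Fin.cons (if k ∈ R then 1 else 0) (v k).ofLp :
        Fin (d + 1) → ℝ)).det := by
  have h0 : restartedWalk R v 0 = v 0 := rfl
  have hs : ∀ k : Fin d, restartedWalk R v k.succ =
      if k.succ ∈ R then v k.succ else restartedWalk R v k.castSucc + v k.succ := fun k => by
    simp only [restartedWalk, Fin.induction_succ]
  refine Matrix.det_eq_of_forall_row_eq_smul_add_pred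
    (fun k => if k.succ ∈ R then 0 else 1) (fun j => ?_) (fun k j => ?_)
  · simp [h0, hR]
  · simp only [Matrix.of_apply, hs]
    split_ifs <;> refine Fin.cases ?_ (fun j => ?_) j <;> simp [add_comm]

-- The transpose places the deterministic vector as first row, the form that the rotation argument
-- uses.
open Classical in
theorem det_restartedWalk_smul {d : ℕ} {R : Set (Fin (d + 1))} (hR : 0 ∈ R)
    {σ : Fin (d + 1) → ℝ} (hσ : ∀ k, 0 < σ k) (x : Fin (d + 1) → EuclideanSpace ℝ (Fin d)) :
    (Matrix.of fun k => (Fin.cons 1 (restartedWalk R (fun k => σ k • x k) k).ofLp :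
        Fin (d + 1) → ℝ)).det =
      (∏ k, σ k) * (rowMatrix (Fin.cons (WithLp.toLp 2 fun k => if k ∈ R then 1 / σ k else 0)
        (fun j : Fin d => (WithLp.toLp 2 fun k => x k j : EuclideanSpace ℝ (Fin (d + 1)))) :
          Fin (d + 1) → EuclideanSpace ℝ (Fin (d + 1)))).det := by
  rw [det_restartedWalk hR, ← Matrix.det_transpose (rowMatrix _), ← Matrix.det_mul_column]
  congr 1
  ext k j
  refine Fin.cases ?_ (fun j => ?_) j
  · simp [rowMatrix, (hσ k).ne']
  · simp [rowMatrix]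

/-! ### The moment formula -/

theorem corollary6p3 {Ω : Type*} [MeasurableSpace Ω] (P : Measure Ω) [IsProbabilityMeasure P]
    (d l : ℕ) (hl : 1 ≤ l)
    (X : Fin (d + 1) → Ω → EuclideanSpace ℝ (Fin d))
    (hX : ∀ k, HasLaw (X k) (stdGaussian (EuclideanSpace ℝ (Fin d))) P)
    (hind : iIndepFun X P)
    (σ : Fin (d + 1) → ℝ) (hσ : ∀ k, 0 < σ k)
    (i : Fin (l + 1) → Fin (d + 1)) (hi : StrictMono i) (hi0 : i 0 = 0)
    (Y : Fin (d + 1) → Ω → EuclideanSpace ℝ (Fin d))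
    (hY : ∀ ω, (fun k => Y k ω) = restartedWalk (Set.range i) (fun k => σ k • X k ω))
    (p : ℝ) (hp : 0 < p) :
    Integrable (fun ω => (volume (convexHull ℝ (Set.range fun k => Y k ω))).toReal ^ p) P ∧
    ∫ ω, (volume (convexHull ℝ (Set.range fun k => Y k ω))).toReal ^ p ∂P =
      ((2 : ℝ) ^ ((d : ℝ) / 2) * (∏ k, σ k) / (d.factorial : ℝ) *
          √(∑ j, 1 / (σ (i j)) ^ 2)) ^ p *
        ∏ k ∈ Finset.Icc 1 d, Real.Gamma (((k : ℝ) + p) / 2) / Real.Gamma ((k : ℝ) / 2) := by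
  classical
  have hσp : 0 < ∏ k, σ k := Finset.prod_pos fun k _ => hσ k
  set u : EuclideanSpace ℝ (Fin (d + 1)) :=
    WithLp.toLp 2 fun k => if k ∈ Set.range i then 1 / σ k else 0
  have hu : ‖u‖ = √(∑ j, 1 / (σ (i j)) ^ 2) := by
    rw [EuclideanSpace.norm_eq, ← Finset.sum_image (s := Finset.univ) (g := i)
      (f := fun k => 1 / σ k ^ 2) hi.injective.injOn]
    congr 1
    have : Finset.image i Finset.univ = Finset.univ.filter (· ∈ Set.range i) := by ext; simp
    rw [this, Finset.sum_filter]
    refine Finset.sum_congr rfl fun k _ => ?_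
    by_cases hk : k ∈ Set.range i
    · simp only [u, if_pos hk]
      simp
    · simp only [u, if_neg hk]
      simp
  set q : ℝ := ((∏ k, σ k) / d.factorial) ^ p
  have hq : 0 ≤ q := by positivity
  set T : (Fin (d + 1) → EuclideanSpace ℝ (Fin d)) → Fin d → EuclideanSpace ℝ (Fin (d + 1)) :=
    fun x j => WithLp.toLp 2 fun k => x k j
  set G : (Fin d → EuclideanSpace ℝ (Fin (d + 1))) → ℝ := fun c =>
    |(rowMatrix (Fin.cons u c : Fin (d + 1) → EuclideanSpace ℝ (Fin (d + 1)))).det| ^ p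
  have hvol : ∀ ω, (volume (convexHull ℝ (Set.range fun k => Y k ω))).toReal ^ p =
      q * G (T fun k => X k ω) := by
    intro ω
    rw [hY ω, volume_convexHull_range, ENNReal.toReal_ofReal (by positivity), det_diff_rows,
      det_restartedWalk_smul (R := Set.range i) ⟨0, hi0⟩ hσ, abs_mul, abs_of_pos hσp, mul_div_right_comm,
      Real.mul_rpow (by positivity) (abs_nonneg _)]
    simp only [q, G, T, u]
  have hT : MeasurePreserving T (Measure.pi fun _ => stdGaussian (EuclideanSpace ℝ (Fin d)))
      (Measure.pi fun _ => stdGaussian (EuclideanSpace ℝ (Fin (d + 1)))) :=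
    measurePreserving_transpose_stdGaussian (Fin (d + 1)) (Fin d)
  have hlaw : HasLaw (fun ω k => X k ω)
      (Measure.pi fun _ => stdGaussian (EuclideanSpace ℝ (Fin d))) P := by
    refine ⟨aemeasurable_pi_iff.mpr fun k => (hX k).aemeasurable, ?_⟩
    rw [hind.map_fun_eq_pi_map fun k => (hX k).aemeasurable]
    simp_rw [(hX _).map_eq]
  have hG : Measurable G := by
    refine (measurable_det_rowMatrix.comp ?_).abs.pow_const p
    refine measurable_pi_lambda _ fun j => ?_
    refine Fin.cases ?_ (fun j => ?_) j
    · simp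
    · simpa using measurable_pi_apply j
  have hC : 0 ≤ ∏ k ∈ Finset.Icc 1 d, 2 ^ (p / 2) *
      (Real.Gamma (((k : ℝ) + p) / 2) / Real.Gamma ((k : ℝ) / 2)) :=
    Finset.prod_nonneg fun k _ => mul_nonneg (by positivity)
      (div_nonneg (Real.Gamma_nonneg_of_nonneg (by positivity))
        (Real.Gamma_nonneg_of_nonneg (by positivity)))
  -- The lower integral yields both the finiteness and the value of the moment.
  have hlint : ∫⁻ ω, ENNReal.ofReal (q * G (T fun k => X k ω)) ∂P =
      ENNReal.ofReal (q * (‖u‖ ^ p * ∏ k ∈ Finset.Icc 1 d, 2 ^ (p / 2) *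
      (Real.Gamma (((k : ℝ) + p) / 2) / Real.Gamma ((k : ℝ) / 2)))) := by
    rw [ENNReal.ofReal_mul hq, ENNReal.ofReal_mul (by positivity), ← gaussianDetMoment_eq hp,
      ← lintegral_det_rowMatrix_cons, ← hT.lintegral_comp hG.ennreal_ofReal,
      ← hlaw.lintegral_comp (f := fun x => ENNReal.ofReal (G (T x)))
        (hG.comp hT.measurable).ennreal_ofReal.aemeasurable,
      ← lintegral_const_mul' _ _ ENNReal.ofReal_ne_top]
    simp_rw [← ENNReal.ofReal_mul hq]
  have hnn : 0 ≤ᵐ[P] fun ω => q * G (T fun k => X k ω) :=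
    .of_forall fun ω => mul_nonneg hq (Real.rpow_nonneg (abs_nonneg _) p)
  have hmeas : AEStronglyMeasurable (fun ω => q * G (T fun k => X k ω)) P :=
    ((((hG.comp hT.measurable).const_mul q).comp_aemeasurable
      hlaw.aemeasurable)).aestronglyMeasurable
  simp_rw [hvol]
  refine ⟨⟨hmeas, ?_⟩, ?_⟩
  · rw [hasFiniteIntegral_iff_ofReal hnn, hlint]
    exact ENNReal.ofReal_lt_top
  -- The `d` factors `2 ^ (p / 2)` combine into `(2 ^ (d / 2)) ^ p`.
  · rw [integral_eq_lintegral_of_nonneg_ae hnn hmeas, hlint,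
      ENNReal.toReal_ofReal (by positivity), Finset.prod_mul_distrib, Finset.prod_const,
      Nat.card_Icc, Nat.add_sub_cancel, hu, mul_div_assoc, Real.mul_rpow (by positivity)
      (by positivity), Real.mul_rpow (by positivity) (by positivity), ← Real.rpow_natCast,
      ← Real.rpow_mul (by norm_num), ← Real.rpow_mul (by norm_num)]
    simp only [q]
    ring_nf
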